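/- Conventions. A finite graph $\mathcal G=(V,E)$ consists of a finite set $V$ of vertices and a set $E\subset V\times V$ of edges (directed, loops allowed, no multiple edges); an edge $\gamma=(s(\gamma),t(\gamma))$ has source $s(\gamma)$ and target $t(\gamma)$. Automorphisms of $\mathcal G$ are the bijections $g$ of $V$ with $(i,j)\in E\iff(g(i),g(j))\in E$. The graph $\mathcal G$ is connected if any two vertices are joined by a finite chain of edges, each traversed in either direction. $\mathcal G^{\amalg n}$ denotes the disjoint union of $n$ copies of $\mathcal G$. The quantum automorphism group $A_{aut}(\mathcal G)$ is the universal unital $C^*$-algebra with generators $(X_{ij})_{i,j\in V}$ and relations $$X_{ij}^*=X_{ij},\quad X_{ij}X_{ik}=\delta_{jk}X_{ij},\quad X_{ji}X_{ki}=\delta_{jk}X_{ji},\quad \sum_{l\in V}X_{il}=1=\sum_{l\in V}X_{li}\qquad(i,j,k\in V),$$ $$X_{s(\gamma)i}X_{t(\gamma)k}=X_{t(\gamma)k}X_{s(\gamma)i}=0,\quad X_{is(\gamma)}X_{kt(\gamma)}=X_{kt(\gamma)}X_{is(\gamma)}=0\qquad(\gamma\in E,\ (i,k)\notin E),$$ $$X_{s(\gamma)s(\gamma')}X_{t(\gamma)t(\gamma')}=X_{t(\gamma)t(\gamma')}X_{s(\gamma)s(\gamma')}\qquad(\gamma,\gamma'\in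 E),$$ $$\sum_{\gamma'\in E}X_{s(\gamma')s(\gamma)}X_{t(\gamma')t(\gamma)}=1=\sum_{\gamma'\in E}X_{s(\gamma)s(\gamma')}X_{t(\gamma)t(\gamma')}\qquad(\gamma\in E).$$ Let $\otimes$ be the minimal tensor product of $C^*$-algebras. A Woronowicz algebra is a unital $C^*$-algebra $A$ with a unital $*$-homomorphism $\Delta:A\to A\otimes A$ for which there is a family of unitary matrices $u^\lambda\in M_{d_\lambda}(A)$, $\lambda\in\Lambda$, such that the subalgebra generated by all the entries $u^\lambda_{ij}$ is dense in $A$, $\Delta(u^\lambda_{ij})=\sum_k u^\lambda_{ik}\otimes u^\lambda_{kj}$ for all $\lambda,i,j$, and each transposed matrix ${}^t u^\lambda$ is invertible. It is cocommutative if $\sigma\circ\Delta=\Delta$, where $\sigma$ is the flip $a\otimes b\mapsto b\otimes a$ of $A\otimes A$. Corollary 4.3. Let $\mathcal G$ be a finite connected graph with non-trivial automorphism group and let $n\ge 2$ be an integer. Then there is a unital $*$-homomorphism $\Delta:A_{aut}(\mathcal G^{\amalg n})\to A_{aut}(\mathcal G^{\amalg n})\otimes A_{aut}(\mathcal G^{\amalg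 n})$ with $\Delta(X_{ij})=\sum_k X_{ik}\otimes X_{kj}$ for all vertices $i,j$ of $\mathcal G^{\amalg n}$, and with this $\Delta$ the algebra $A_{aut}(\mathcal G^{\amalg n})$ is an infinite-dimensional, noncommutative and noncocommutative Woronowicz algebra. -/

import Mathlib

open scoped TensorProduct

universe u

noncomputable section

/-! ### C⋆-seminorms and the C⋆-algebras they define -/

/-- A C⋆-seminorm on a unital complex ⋆-algebra `F`. -/
structure CStarSeminorm (F : Type*) [Ring F] [StarRing F] [Algebra ℂ F] extends
    Seminorm ℂ F where
  mul_le' : ∀ x y, toFun (x * y) ≤ toFun x * toFun y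
  star_mul_self' : ∀ x, toFun (star x * x) = toFun x * toFun x

namespace CStarSeminorm

section Basic

variable {F : Type*} [Ring F] [StarRing F] [Algebra ℂ F]

instance : CoeFun (CStarSeminorm F) (fun _ => F → ℝ) := ⟨fun p => p.toSeminorm⟩

lemma mul_le (p : CStarSeminorm F) (x y : F) : p (x * y) ≤ p x * p y := p.mul_le' x y

lemma star_mul_self (p : CStarSeminorm F) (x : F) : p (star x * x) = p x * p x :=
  p.star_mul_self' x

lemma nonneg (p : CStarSeminorm F) (x : F) : 0 ≤ p x := apply_nonneg p.toSeminorm x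

lemma le_map_star (p : CStarSeminorm F) (x : F) : p x ≤ p (star x) := by
  have h := p.mul_le (star x) x
  rw [star_mul_self] at h
  rcases (p.nonneg x).eq_or_lt with h0 | h0
  · rw [← h0]; exact p.nonneg _
  · exact le_of_mul_le_mul_right h h0

lemma apply_star (p : CStarSeminorm F) (x : F) : p (star x) = p x :=
  le_antisymm (by simpa using p.le_map_star (star x)) (p.le_map_star x)

lemma map_one_le (p : CStarSeminorm F) : p 1 ≤ 1 := by
  have h := p.star_mul_self 1
  rw [star_one, one_mul] at h
  nlinarith [p.nonneg 1]

/-- The pointwise supremum of a pointwise bounded set of C⋆-seminorms. -/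
def sup (S : Set (CStarSeminorm F))
    (hS : ∀ x, BddAbove (Set.range fun p : S => p.1 x)) : CStarSeminorm F where
  toFun x := ⨆ p : S, p.1 x
  map_zero' := by simp
  add_le' x y := Real.iSup_le
    (fun p => (map_add_le_add p.1.toSeminorm x y).trans
      (add_le_add (le_ciSup (hS x) p) (le_ciSup (hS y) p)))
    (add_nonneg (Real.iSup_nonneg fun p => p.1.nonneg x) (Real.iSup_nonneg fun p => p.1.nonneg y))
  neg' x := by simp
  smul' a x := by
    simp only [map_smul_eq_mul]
    exact (Real.mul_iSup_of_nonneg (norm_nonneg a) _).symm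
  mul_le' x y := Real.iSup_le
    (fun p => (p.1.mul_le x y).trans
      (mul_le_mul (le_ciSup (hS x) p) (le_ciSup (hS y) p) (p.1.nonneg y)
        (Real.iSup_nonneg fun p => p.1.nonneg x)))
    (mul_nonneg (Real.iSup_nonneg fun p => p.1.nonneg x) (Real.iSup_nonneg fun p => p.1.nonneg y))
  star_mul_self' x := by
    have h0 : 0 ≤ ⨆ p : S, p.1 x := Real.iSup_nonneg fun p => p.1.nonneg x
    have h1 : 0 ≤ ⨆ p : S, p.1 (star x * x) := Real.iSup_nonneg fun p => p.1.nonneg _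
    apply le_antisymm
    · refine Real.iSup_le (fun p => ?_) (mul_nonneg h0 h0)
      rw [star_mul_self]
      exact mul_self_le_mul_self (p.1.nonneg x) (le_ciSup (hS x) p)
    · have h2 : ⨆ p : S, p.1 x ≤ Real.sqrt (⨆ p : S, p.1 (star x * x)) := by
        refine Real.iSup_le (fun p => Real.le_sqrt_of_sq_le ?_) (Real.sqrt_nonneg _)
        rw [sq, ← star_mul_self]
        exact le_ciSup (hS (star x * x)) p
      calc _ ≤ _ := mul_self_le_mul_self h0 h2
        _ = _ := Real.mul_self_sqrt h1

lemma sup_apply (S : Set (CStarSeminorm F)) (hS) (x : F) : sup S hS x = ⨆ p : S, p.1 x := rfl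

/-- The C⋆-seminorm `x ↦ ‖f x‖` defined by a ⋆-homomorphism to a C⋆-algebra. -/
def ofHom {B : Type*} [CStarAlgebra B] (f : F →⋆ₐ[ℂ] B) : CStarSeminorm F where
  toFun x := ‖f x‖
  map_zero' := by rw [map_zero, norm_zero]
  add_le' x y := by rw [map_add]; exact norm_add_le _ _
  neg' x := by rw [map_neg, norm_neg]
  smul' a x := by rw [map_smul, norm_smul]
  mul_le' x y := by rw [map_mul]; exact norm_mul_le _ _
  star_mul_self' x := by rw [map_mul, map_star, CStarRing.norm_star_mul_self]

lemma ofHom_apply {B : Type*} [CStarAlgebra B] (f : F →⋆ₐ[ℂ] B) (x : F) :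
    ofHom f x = ‖f x‖ := rfl

end Basic

section Completion

variable {F : Type*} [Ring F] [StarRing F] [Algebra ℂ F]

/-- The ⋆-algebra `F`, regarded as a seminormed ring through `p`. -/
def Pre (_ : CStarSeminorm F) : Type _ := F

variable (p : CStarSeminorm F)

instance : SeminormedRing p.Pre where
  __ := (inferInstanceAs (Ring F) : Ring p.Pre)
  __ := AddGroupSeminorm.toSeminormedAddCommGroup (E := F) p.toAddGroupSeminorm
  norm_mul_le := p.mul_le

instance : StarRing p.Pre := inferInstanceAs (StarRing F)

instance : NormedAlgebra ℂ p.Pre where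
  __ := (inferInstanceAs (Algebra ℂ F) : Algebra ℂ p.Pre)
  norm_smul_le a x := (p.smul' a x).le

lemma norm_pre (x : F) : ‖(show p.Pre from x)‖ = p x := rfl

/-- The Hausdorff completion of `F` with respect to the C⋆-seminorm `p`: the quotient of `F` by
the null space of `p`, completed in the norm induced by `p`. -/
def Completion : Type _ := UniformSpace.Completion p.Pre

instance : NormedRing p.Completion := inferInstanceAs (NormedRing (UniformSpace.Completion p.Pre))
instance : CompleteSpace p.Completion :=
  inferInstanceAs (CompleteSpace (UniformSpace.Completion p.Pre))
instance : Algebra ℂ p.Completion := inferInstanceAs (Algebra ℂ (UniformSpace.Completion p.Pre))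

/-- The canonical ⋆-homomorphism from `F` to its completion, as a function. -/
def coe (x : F) : p.Completion := ((show p.Pre from x : p.Pre) : UniformSpace.Completion p.Pre)

lemma norm_coe (x : F) : ‖p.coe x‖ = p x :=
  UniformSpace.Completion.norm_coe (E := p.Pre) x

lemma coe_add (x y : F) : p.coe (x + y) = p.coe x + p.coe y :=
  UniformSpace.Completion.coe_add (α := p.Pre) x y

lemma coe_mul (x y : F) : p.coe (x * y) = p.coe x * p.coe y :=
  UniformSpace.Completion.coe_mul (α := p.Pre) x y

lemma coe_one : p.coe 1 = 1 := UniformSpace.Completion.coe_one (α := p.Pre)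

lemma coe_zero : p.coe 0 = 0 := UniformSpace.Completion.coe_zero (α := p.Pre)

lemma coe_algebraMap (a : ℂ) : p.coe (algebraMap ℂ F a) = algebraMap ℂ p.Completion a := rfl

lemma denseRange_coe : DenseRange p.coe := UniformSpace.Completion.denseRange_coe (α := p.Pre)

lemma coe_smul (a : ℂ) (x : F) : p.coe (a • x) = a • p.coe x := by
  rw [Algebra.smul_def, Algebra.smul_def, coe_mul, coe_algebraMap]

lemma isometry_star_pre : Isometry (star : p.Pre → p.Pre) :=
  AddMonoidHomClass.isometry_of_norm (starAddEquiv : p.Pre ≃+ p.Pre) fun x => p.apply_star x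

instance : Star p.Completion :=
  ⟨UniformSpace.Completion.map (star : p.Pre → p.Pre)⟩

lemma coe_star (x : F) : p.coe (star x) = star (p.coe x) :=
  (UniformSpace.Completion.map_coe p.isometry_star_pre.uniformContinuous x).symm

instance : ContinuousStar p.Completion :=
  ⟨UniformSpace.Completion.continuous_map⟩

/-- Closed properties of elements of the completion may be checked on the image of `F`. -/
lemma completion_induction {P : p.Completion → Prop} (x : p.Completion)
    (hP : IsClosed {y | P y}) (h : ∀ x : F, P (p.coe x)) : P x :=
  UniformSpace.Completion.induction_on (α := p.Pre) x hP h

instance : StarRing p.Completion where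
  star_involutive x := by
    induction x using p.completion_induction with
    | hP => exact isClosed_eq (by fun_prop) (by fun_prop)
    | h x =>
    rw [← coe_star, ← coe_star, star_star]
  star_mul x y := by
    induction x using p.completion_induction with
    | hP => exact isClosed_eq (by fun_prop) (by fun_prop)
    | h x =>
    induction y using p.completion_induction with
    | hP => exact isClosed_eq (by fun_prop) (by fun_prop)
    | h y =>
    rw [← coe_mul, ← coe_star, ← coe_star, ← coe_star, ← coe_mul, star_mul]
  star_add x y := by
    induction x using p.completion_induction with
    | hP => exact isClosed_eq (by fun_prop) (by fun_prop)
    | h x =>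
    induction y using p.completion_induction with
    | hP => exact isClosed_eq (by fun_prop) (by fun_prop)
    | h y =>
    rw [← coe_add, ← coe_star, ← coe_star, ← coe_star, ← coe_add, star_add]

lemma continuous_smul_completion (a : ℂ) : Continuous fun x : p.Completion => a • x := by
  simp only [Algebra.smul_def]
  exact continuous_const_mul _

instance : NormedAlgebra ℂ p.Completion where
  norm_smul_le a x := by
    induction x using p.completion_induction with
    | hP =>
      exact isClosed_le (p.continuous_smul_completion a).norm
        (continuous_const.mul continuous_norm)
    | h x =>
    rw [← coe_smul, norm_coe, norm_coe]
    exact (p.smul' a x).le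

instance : CStarRing p.Completion where
  norm_mul_self_le x := by
    induction x using p.completion_induction with
    | hP => exact isClosed_le (by fun_prop) (by fun_prop)
    | h x =>
    rw [← coe_star, ← coe_mul, norm_coe, norm_coe, star_mul_self]

instance [StarModule ℂ F] : StarModule ℂ p.Completion where
  star_smul a x := by
    induction x using p.completion_induction with
    | hP =>
      exact isClosed_eq (p.continuous_smul_completion a).star
        ((p.continuous_smul_completion _).comp continuous_star)
    | h x =>
    rw [← coe_smul, ← coe_star, ← coe_star, star_smul, coe_smul]

/-- The completion of a ⋆-algebra with respect to a C⋆-seminorm is a C⋆-algebra. -/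
instance [StarModule ℂ F] : CStarAlgebra p.Completion where
  __ := (inferInstance : NormedAlgebra ℂ p.Completion)
  __ := (inferInstance : StarModule ℂ p.Completion)

/-- The canonical ⋆-homomorphism from `F` to its completion. -/
def toCompletion [StarModule ℂ F] : F →⋆ₐ[ℂ] p.Completion where
  toFun := p.coe
  map_one' := p.coe_one
  map_mul' := p.coe_mul
  map_zero' := p.coe_zero
  map_add' := p.coe_add
  commutes' := p.coe_algebraMap
  map_star' := p.coe_star

/-- A ⋆-homomorphism from `F` to a C⋆-algebra that is dominated by `p` extends to the
completion. -/
def lift [StarModule ℂ F] {B : Type*} [CStarAlgebra B] (f : F →⋆ₐ[ℂ] B)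
    (hf : ∀ x, ‖f x‖ ≤ p x) : p.Completion →⋆ₐ[ℂ] B :=
  let f' : p.Pre →+ B := AddMonoidHomClass.toAddMonoidHom f
  have hc : UniformContinuous f' :=
    AddMonoidHomClass.uniformContinuous_of_bound f' 1 fun x => by
      rw [one_mul]; exact hf x
  have hE : Continuous (UniformSpace.Completion.extension f' : p.Completion → B) :=
    UniformSpace.Completion.continuous_extension
  have h (x : F) : (UniformSpace.Completion.extension f' : p.Completion → B) (p.coe x) = f x :=
    UniformSpace.Completion.extension_coe (α := p.Pre) hc x
  { toFun := (UniformSpace.Completion.extension f' : p.Completion → B)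
    map_one' := by rw [← coe_one, h, map_one]
    map_mul' := fun x y => by
      induction x using p.completion_induction with
      | hP => exact isClosed_eq (by fun_prop) (by fun_prop)
      | h x =>
      induction y using p.completion_induction with
      | hP => exact isClosed_eq (by fun_prop) (by fun_prop)
      | h y =>
      rw [← coe_mul, h, h, h, map_mul]
    map_zero' := by rw [← coe_zero, h, map_zero]
    map_add' := fun x y => by
      induction x using p.completion_induction with
      | hP => exact isClosed_eq (by fun_prop) (by fun_prop)
      | h x =>
      induction y using p.completion_induction with
      | hP => exact isClosed_eq (by fun_prop) (by fun_prop)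
      | h y =>
      rw [← coe_add, h, h, h, map_add]
    commutes' := fun a => by
      rw [← coe_algebraMap, h, AlgHomClass.commutes]
    map_star' := fun x => by
      induction x using p.completion_induction with
      | hP => exact isClosed_eq (by fun_prop) (by fun_prop)
      | h x =>
      rw [← coe_star, h, h, map_star] }

lemma lift_coe [StarModule ℂ F] {B : Type*} [CStarAlgebra B] (f : F →⋆ₐ[ℂ] B)
    (hf : ∀ x, ‖f x‖ ≤ p x) (x : F) : p.lift f hf (p.toCompletion x) = f x := by
  let f' : p.Pre →+ B := AddMonoidHomClass.toAddMonoidHom f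
  have hc : UniformContinuous f' :=
    AddMonoidHomClass.uniformContinuous_of_bound f' 1 fun x => by
      rw [one_mul]; exact hf x
  exact UniformSpace.Completion.extension_coe (α := p.Pre) hc x

end Completion
end CStarSeminorm
/-! ### Universal C⋆-algebras on self-adjoint generators -/

/-- The free unital complex ⋆-algebra on a set `X` of self-adjoint generators: the algebra of
noncommutative polynomials in `X`. -/
def FreeSelfAdj (X : Type*) : Type _ := MonoidAlgebra ℂ (FreeMonoid X)

namespace FreeSelfAdj

variable {X : Type*}

instance : Ring (FreeSelfAdj X) := inferInstanceAs (Ring (MonoidAlgebra ℂ (FreeMonoid X)))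
instance : Algebra ℂ (FreeSelfAdj X) :=
  inferInstanceAs (Algebra ℂ (MonoidAlgebra ℂ (FreeMonoid X)))

/-- The monomial `c • w`. -/
def monomial (w : FreeMonoid X) (c : ℂ) : FreeSelfAdj X := MonoidAlgebra.single w c

/-- The generator indexed by `x`. -/
def gen (x : X) : FreeSelfAdj X := monomial (FreeMonoid.of x) 1

lemma monomial_mul (w w' : FreeMonoid X) (c c' : ℂ) :
    monomial w c * monomial w' c' = monomial (w * w') (c * c') :=
  MonoidAlgebra.single_mul_single ..

lemma smul_monomial (w : FreeMonoid X) (a c : ℂ) : a • monomial w c = monomial w (a * c) :=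
  MonoidAlgebra.smul_single ..

lemma one_def : (1 : FreeSelfAdj X) = monomial 1 1 := rfl

lemma induction {P : FreeSelfAdj X → Prop} (x : FreeSelfAdj X) (zero : P 0)
    (add : ∀ x y, P x → P y → P (x + y)) (monomial : ∀ w c, P (monomial w c)) : P x :=
  MonoidAlgebra.induction_linear x zero (fun x y => add x y) monomial

/-- The antilinear antimultiplicative map `c • w ↦ conj c • (reverse of w)`. -/
def starHom : MonoidAlgebra ℂ (FreeMonoid X) →+* (MonoidAlgebra ℂ (FreeMonoid X))ᵐᵒᵖ :=
  MonoidAlgebra.liftNCRingHom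
    ((algebraMap ℂ (MonoidAlgebra ℂ (FreeMonoid X))ᵐᵒᵖ).comp (starRingEnd ℂ))
    { toFun := fun w => MulOpposite.op (MonoidAlgebra.single (star w) 1)
      map_one' := rfl
      map_mul' := fun w w' => by
        rw [← MulOpposite.op_mul, MonoidAlgebra.single_mul_single, star_mul, one_mul] }
    (fun c _ => Algebra.commutes (starRingEnd ℂ c) _)

lemma starHom_single (w : FreeMonoid X) (c : ℂ) :
    starHom (MonoidAlgebra.single w c) = MulOpposite.op (MonoidAlgebra.single (star w) (star c)) := by
  refine (MonoidAlgebra.liftNCRingHom_single _ _ _ _ _).trans ?_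
  simp only [RingHom.comp_apply, ← Algebra.smul_def]
  change star c • MulOpposite.op (MonoidAlgebra.single (star w) 1) = _
  rw [← MulOpposite.op_smul, MonoidAlgebra.smul_single, smul_eq_mul, mul_one]

instance : Star (FreeSelfAdj X) := ⟨fun x => (starHom x).unop⟩

lemma star_monomial (w : FreeMonoid X) (c : ℂ) :
    star (monomial w c) = monomial (star w) (star c) :=
  congrArg MulOpposite.unop (starHom_single w c)

lemma star_zero' : star (0 : FreeSelfAdj X) = 0 :=
  congrArg MulOpposite.unop (map_zero starHom)

lemma star_add' (x y : FreeSelfAdj X) : star (x + y) = star x + star y :=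
  congrArg MulOpposite.unop (map_add starHom x y)

instance : StarRing (FreeSelfAdj X) where
  star_mul x y := congrArg MulOpposite.unop (map_mul starHom x y)
  star_add := star_add'
  star_involutive x := by
    induction x using induction with
    | zero => rw [star_zero', star_zero']
    | add x y hx hy => rw [star_add', star_add', hx, hy]
    | monomial w c => rw [star_monomial, star_monomial, star_star, star_star]

instance : StarModule ℂ (FreeSelfAdj X) where
  star_smul a x := by
    induction x using induction with
    | zero => simp
    | add x y hx hy => rw [smul_add, star_add, hx, hy, star_add, smul_add]
    | monomial w c =>
      rw [smul_monomial, star_monomial, star_monomial, smul_monomial, star_mul, mul_comm]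

lemma star_gen (x : X) : star (gen x) = gen x := by
  rw [gen, star_monomial]; simp

/-- A C⋆-seminorm is controlled on `FreeSelfAdj X` once it is controlled on the generators. -/
lemma exists_bound (S : Set (CStarSeminorm (FreeSelfAdj X)))
    (hS : ∀ p ∈ S, ∀ x, p (gen x) ≤ 1) (a : FreeSelfAdj X) :
    BddAbove (Set.range fun p : S => p.1 a) := by
  suffices h : ∃ C, ∀ p ∈ S, p a ≤ C by
    obtain ⟨C, hC⟩ := h
    exact ⟨C, by rintro _ ⟨p, rfl⟩; exact hC p.1 p.2⟩
  induction a using induction with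
  | zero => exact ⟨0, fun p _ => (map_zero p.toSeminorm).le⟩
  | add a b ha hb =>
    obtain ⟨C, hC⟩ := ha
    obtain ⟨D, hD⟩ := hb
    exact ⟨C + D, fun p hp => (map_add_le_add p.toSeminorm a b).trans
      (add_le_add (hC p hp) (hD p hp))⟩
  | monomial w c =>
    refine ⟨‖c‖, fun p hp => ?_⟩
    have hw : p (monomial w 1) ≤ 1 := by
      induction w using FreeMonoid.inductionOn' with
      | one => exact p.map_one_le
      | of_mul x w hw =>
        have : monomial (FreeMonoid.of x * w) 1 = gen x * monomial w 1 := by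
          rw [gen, monomial_mul, one_mul]
        rw [this]
        exact (p.mul_le _ _).trans (mul_le_one₀ (hS p hp x) (p.nonneg _) hw)
    have : monomial w c = c • monomial w 1 := by rw [smul_monomial, mul_one]
    rw [this, map_smul_eq_mul]
    exact mul_le_of_le_one_right (norm_nonneg c) hw

end FreeSelfAdj

/-! ### Finite graphs and their quantum automorphism groups -/

namespace Digraph

/-- A directed graph is connected if any two vertices are joined by a finite chain of edges,
where edges may be traversed in either direction. -/
def IsConnected {V : Type*} (G : Digraph V) : Prop :=
  ∀ i j, Relation.EqvGen G.Adj i j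

/-- The disjoint union of `n` copies of `G`; the vertex `(k, i)` is the vertex `i` of the
`k`-th copy. -/
def copies {V : Type*} (G : Digraph V) (n : ℕ) : Digraph (Fin n × V) where
  Adj a b := a.1 = b.1 ∧ G.Adj a.2 b.2

variable {V : Type*} [Fintype V] (G : Digraph V)

open Classical in
/-- The set of edges of a finite directed graph. -/
def edges : Finset (V × V) := Finset.univ.filter fun e => G.Adj e.1 e.2

end Digraph

/-- The generator `X i j` of the free ⋆-algebra on self-adjoint symbols indexed by `V × V`. -/
abbrev QAut.entry {V : Type*} (i j : V) : FreeSelfAdj (V × V) := FreeSelfAdj.gen (i, j)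

open QAut in
/-- The defining relations of the quantum automorphism group of a finite graph `G`:
`QAutRel G a b` says that `a = b` is one of the defining equations, where `a` and `b` are
polynomials in the self-adjoint symbols `X i j`, written `entry i j`. An edge is a pair
`γ = (γ.1, γ.2)` formed by its source and its target. -/
inductive QAutRel {V : Type*} [Fintype V] (G : Digraph V) :
    FreeSelfAdj (V × V) → FreeSelfAdj (V × V) → Prop
  | row_idem (i j : V) : QAutRel G (entry i j * entry i j) (entry i j)
  | row_orth (i j k : V) (h : j ≠ k) : QAutRel G (entry i j * entry i k) 0
  | col_orth (i j k : V) (h : j ≠ k) : QAutRel G (entry j i * entry k i) 0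
  | row_sum (i : V) : QAutRel G (∑ l, entry i l) 1
  | col_sum (i : V) : QAutRel G (∑ l, entry l i) 1
  | edge_row (γ : V × V) (i k : V) (hγ : γ ∈ G.edges) (h : ¬ G.Adj i k) :
      QAutRel G (entry γ.1 i * entry γ.2 k) 0
  | edge_row' (γ : V × V) (i k : V) (hγ : γ ∈ G.edges) (h : ¬ G.Adj i k) :
      QAutRel G (entry γ.2 k * entry γ.1 i) 0
  | edge_col (γ : V × V) (i k : V) (hγ : γ ∈ G.edges) (h : ¬ G.Adj i k) :
      QAutRel G (entry i γ.1 * entry k γ.2) 0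
  | edge_col' (γ : V × V) (i k : V) (hγ : γ ∈ G.edges) (h : ¬ G.Adj i k) :
      QAutRel G (entry k γ.2 * entry i γ.1) 0
  | edge_comm (γ γ' : V × V) (hγ : γ ∈ G.edges) (hγ' : γ' ∈ G.edges) :
      QAutRel G (entry γ.1 γ'.1 * entry γ.2 γ'.2) (entry γ.2 γ'.2 * entry γ.1 γ'.1)
  | edge_sum (γ : V × V) (hγ : γ ∈ G.edges) :
      QAutRel G (∑ γ' ∈ G.edges, entry γ'.1 γ.1 * entry γ'.2 γ.2) 1
  | edge_sum' (γ : V × V) (hγ : γ ∈ G.edges) :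
      QAutRel G (∑ γ' ∈ G.edges, entry γ.1 γ'.1 * entry γ.2 γ'.2) 1

section QAut

variable {V : Type*} [Fintype V] (G : Digraph V)

/-- The C⋆-seminorms on the free ⋆-algebra for which the relations of `G` hold. -/
def qAutSeminorms : Set (CStarSeminorm (FreeSelfAdj (V × V))) :=
  {p | ∀ a b, QAutRel G a b → p (a - b) = 0}

lemma qAutSeminorms_gen_le (p) (hp : p ∈ qAutSeminorms G) (x : V × V) :
    p (FreeSelfAdj.gen x) ≤ 1 := by
  obtain ⟨i, j⟩ := x
  have h := p.star_mul_self (QAut.entry i j)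
  have h1 : p (QAut.entry i j * QAut.entry i j) = p (QAut.entry i j) := by
    have h2 := hp _ _ (QAutRel.row_idem i j)
    have h3 := abs_sub_map_le_sub p.toSeminorm (QAut.entry i j * QAut.entry i j) (QAut.entry i j)
    rw [h2] at h3
    linarith [abs_le.1 h3]
  rw [FreeSelfAdj.star_gen, h1] at h
  have h0 := p.nonneg (QAut.entry i j)
  change p (QAut.entry i j) ≤ 1
  nlinarith

/-- The largest C⋆-seminorm on the free ⋆-algebra for which the relations of `G` hold. -/
def qAutSeminorm : CStarSeminorm (FreeSelfAdj (V × V)) :=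
  CStarSeminorm.sup (qAutSeminorms G)
    (FreeSelfAdj.exists_bound _ (qAutSeminorms_gen_le G))

/-- The quantum automorphism group `A_aut(G)` of a finite graph `G`: the universal C⋆-algebra
on self-adjoint generators `X i j` with relations `QAutRel G`. -/
def QAut : Type _ := (qAutSeminorm G).Completion

instance : CStarAlgebra (QAut G) := inferInstanceAs (CStarAlgebra (qAutSeminorm G).Completion)

/-- The canonical ⋆-homomorphism from the free ⋆-algebra to `A_aut(G)`. -/
def QAut.mk : FreeSelfAdj (V × V) →⋆ₐ[ℂ] QAut G := (qAutSeminorm G).toCompletion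

/-- The generator `X i j` of `A_aut(G)`. -/
def QAut.gen (i j : V) : QAut G := QAut.mk G (QAut.entry i j)

end QAut

/-! ### The Hilbert space tensor product and tensor products of representations -/

section Spatial

variable (H K : Type u) [NormedAddCommGroup H] [InnerProductSpace ℂ H]
  [NormedAddCommGroup K] [InnerProductSpace ℂ K]

/-- The Hilbert space tensor product: the completion of the algebraic tensor product `H ⊗ K` for
the inner product `⟪h ⊗ k, h' ⊗ k'⟫ = ⟪h, h'⟫ ⟪k, k'⟫`. -/
def HilbertTensor : Type u := UniformSpace.Completion (H ⊗[ℂ] K)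

instance : NormedAddCommGroup (HilbertTensor H K) :=
  inferInstanceAs (NormedAddCommGroup (UniformSpace.Completion (H ⊗[ℂ] K)))
instance : InnerProductSpace ℂ (HilbertTensor H K) :=
  inferInstanceAs (InnerProductSpace ℂ (UniformSpace.Completion (H ⊗[ℂ] K)))
instance : CompleteSpace (HilbertTensor H K) :=
  inferInstanceAs (CompleteSpace (UniformSpace.Completion (H ⊗[ℂ] K)))

variable {H K}

namespace HilbertTensor

/-- The embedding of the algebraic tensor product. -/
def coe (v : H ⊗[ℂ] K) : HilbertTensor H K := (v : UniformSpace.Completion (H ⊗[ℂ] K))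

lemma norm_coe (v : H ⊗[ℂ] K) : ‖coe v‖ = ‖v‖ := UniformSpace.Completion.norm_coe v

lemma inner_coe (v w : H ⊗[ℂ] K) : inner ℂ (coe v) (coe w) = inner ℂ v w :=
  UniformSpace.Completion.inner_coe v w

lemma coe_zero : coe (0 : H ⊗[ℂ] K) = 0 := UniformSpace.Completion.coe_zero

lemma coe_add (v w : H ⊗[ℂ] K) : coe (v + w) = coe v + coe w :=
  UniformSpace.Completion.coe_add v w

lemma coe_smul (c : ℂ) (v : H ⊗[ℂ] K) : coe (c • v) = c • coe v :=
  UniformSpace.Completion.coe_smul c v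

lemma induction {P : HilbertTensor H K → Prop} (v : HilbertTensor H K)
    (hP : IsClosed {v | P v}) (h : ∀ v : H ⊗[ℂ] K, P (coe v)) : P v :=
  UniformSpace.Completion.induction_on v hP h

lemma clm_ext {E : Type*} [NormedAddCommGroup E] [NormedSpace ℂ E]
    {S T : HilbertTensor H K →L[ℂ] E} (h : ∀ x y, S (coe (x ⊗ₜ y)) = T (coe (x ⊗ₜ y))) :
    S = T := by
  ext v
  induction v using induction with
  | hP => exact isClosed_eq S.continuous T.continuous
  | h v =>
    induction v using TensorProduct.induction_on with
    | zero => rw [coe_zero, map_zero, map_zero]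
    | add v w hv hw => rw [coe_add, map_add, map_add, hv, hw]
    | tmul x y => exact h x y

/-- The tensor product `S ⊗ T` of bounded operators, `(S ⊗ T)(h ⊗ k) = S h ⊗ T k`. -/
def map (S : H →L[ℂ] H) (T : K →L[ℂ] K) : HilbertTensor H K →L[ℂ] HilbertTensor H K :=
  (TensorProduct.mapL S T).completion

lemma map_coe (S : H →L[ℂ] H) (T : K →L[ℂ] K) (v : H ⊗[ℂ] K) :
    map S T (coe v) = coe (TensorProduct.mapL S T v) :=
  UniformSpace.Completion.map_coe (TensorProduct.mapL S T).uniformContinuous v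

lemma map_tmul (S : H →L[ℂ] H) (T : K →L[ℂ] K) (x : H) (y : K) :
    map S T (coe (x ⊗ₜ y)) = coe (S x ⊗ₜ T y) := by
  rw [map_coe, TensorProduct.mapL_tmul]

lemma map_add_left (S S' : H →L[ℂ] H) (T : K →L[ℂ] K) :
    map (S + S') T = map S T + map S' T :=
  clm_ext fun x y => by
    simp only [add_apply, map_tmul, TensorProduct.add_tmul, coe_add]

lemma map_add_right (S : H →L[ℂ] H) (T T' : K →L[ℂ] K) :
    map S (T + T') = map S T + map S T' :=
  clm_ext fun x y => by
    simp only [add_apply, map_tmul, TensorProduct.tmul_add, coe_add]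

lemma map_smul_left (c : ℂ) (S : H →L[ℂ] H) (T : K →L[ℂ] K) : map (c • S) T = c • map S T :=
  clm_ext fun x y => by
    simp only [smul_apply, map_tmul, ← TensorProduct.smul_tmul', coe_smul]

lemma map_smul_right (c : ℂ) (S : H →L[ℂ] H) (T : K →L[ℂ] K) : map S (c • T) = c • map S T :=
  clm_ext fun x y => by
    simp only [smul_apply, map_tmul, TensorProduct.tmul_smul, coe_smul]

lemma map_mul (S S' : H →L[ℂ] H) (T T' : K →L[ℂ] K) :
    map (S * S') (T * T') = map S T * map S' T' :=
  clm_ext fun x y => by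
    simp only [mul_apply_eq_comp, map_tmul]

lemma map_one : map (1 : H →L[ℂ] H) (1 : K →L[ℂ] K) = 1 :=
  clm_ext fun x y => by
    simp only [one_apply_eq_self, map_tmul]

lemma map_star [CompleteSpace H] [CompleteSpace K] (S : H →L[ℂ] H) (T : K →L[ℂ] K) :
    map (star S) (star T) = star (map S T) := by
  rw [ContinuousLinearMap.star_eq_adjoint (map S T), ContinuousLinearMap.eq_adjoint_iff]
  intro v w
  induction v using induction with
  | hP => exact isClosed_eq (by fun_prop) (by fun_prop)
  | h v =>
  induction w using induction with
  | hP => exact isClosed_eq (by fun_prop) (by fun_prop)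
  | h w =>
  induction v using TensorProduct.induction_on with
  | zero => simp only [coe_zero, map_zero, inner_zero_left]
  | add v v' hv hv' => simp only [coe_add, map_add, inner_add_left, hv, hv']
  | tmul x y =>
  induction w using TensorProduct.induction_on with
  | zero => simp only [coe_zero, map_zero, inner_zero_right]
  | add w w' hw hw' => simp only [coe_add, map_add, inner_add_right, hw, hw']
  | tmul x' y' =>
    simp only [map_tmul, inner_coe, TensorProduct.inner_tmul,
      ContinuousLinearMap.star_eq_adjoint, ContinuousLinearMap.adjoint_inner_left]

lemma norm_map_le (S : H →L[ℂ] H) (T : K →L[ℂ] K) : ‖map S T‖ ≤ ‖S‖ * ‖T‖ := by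
  refine ContinuousLinearMap.opNorm_le_bound _ (by positivity) fun v => ?_
  induction v using induction with
  | hP => exact isClosed_le (by fun_prop) (by fun_prop)
  | h v =>
    rw [map_coe, norm_coe, norm_coe]
    exact (TensorProduct.mapL S T).le_of_opNorm_le (TensorProduct.norm_mapL_le S T) v

end HilbertTensor

/-- The algebraic tensor product of two complex algebras. -/
abbrev AlgTensor (A B : Type u) [Ring A] [Algebra ℂ A] [Ring B] [Algebra ℂ B] : Type u :=
  A ⊗[ℂ] B

section
variable {A B : Type u} [Ring A] [Algebra ℂ A] [StarRing A] [StarModule ℂ A]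
  [Ring B] [Algebra ℂ B] [StarRing B] [StarModule ℂ B] [CompleteSpace H] [CompleteSpace K]

/-- The algebra homomorphism underlying `tensorRep`. -/
def tensorAlgHom (π : A →⋆ₐ[ℂ] (H →L[ℂ] H)) (ρ : B →⋆ₐ[ℂ] (K →L[ℂ] K)) :
    AlgTensor A B →ₐ[ℂ] (HilbertTensor H K →L[ℂ] HilbertTensor H K) :=
  Algebra.TensorProduct.algHomOfLinearMapTensorProduct
    (TensorProduct.lift (LinearMap.mk₂ ℂ (fun a b => HilbertTensor.map (π a) (ρ b))
      (fun a a' b => by rw [map_add, HilbertTensor.map_add_left])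
      (fun c a b => by rw [map_smul, HilbertTensor.map_smul_left])
      (fun a b b' => by rw [map_add, HilbertTensor.map_add_right])
      (fun c a b => by rw [map_smul, HilbertTensor.map_smul_right])))
    (fun a a' b b' => by
      simp only [TensorProduct.lift.tmul, LinearMap.mk₂_apply, map_mul, HilbertTensor.map_mul])
    (by
      simp only [TensorProduct.lift.tmul, LinearMap.mk₂_apply, map_one]
      exact HilbertTensor.map_one)

lemma tensorAlgHom_star (π : A →⋆ₐ[ℂ] (H →L[ℂ] H)) (ρ : B →⋆ₐ[ℂ] (K →L[ℂ] K))
    (x : AlgTensor A B) : tensorAlgHom π ρ (star x) = star (tensorAlgHom π ρ x) := by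
  induction x using TensorProduct.induction_on with
  | zero => rw [star_zero, map_zero, star_zero]
  | add x y hx hy => rw [star_add, map_add, map_add, star_add, hx, hy]
  | tmul a b =>
    change HilbertTensor.map (π (star a)) (ρ (star b)) = star (HilbertTensor.map (π a) (ρ b))
    rw [map_star, map_star, HilbertTensor.map_star]

/-- The representation `π ⊗ ρ` of the algebraic tensor product `A ⊗ B` on the Hilbert space tensor
product of `H` and `K`, with `(π ⊗ ρ)(a ⊗ b) = π a ⊗ ρ b`. -/
def tensorRep (π : A →⋆ₐ[ℂ] (H →L[ℂ] H)) (ρ : B →⋆ₐ[ℂ] (K →L[ℂ] K)) :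
    AlgTensor A B →⋆ₐ[ℂ] (HilbertTensor H K →L[ℂ] HilbertTensor H K) where
  toAlgHom := tensorAlgHom π ρ
  map_star' := tensorAlgHom_star π ρ

lemma tensorRep_tmul (π : A →⋆ₐ[ℂ] (H →L[ℂ] H)) (ρ : B →⋆ₐ[ℂ] (K →L[ℂ] K)) (a : A) (b : B) :
    tensorRep π ρ (a ⊗ₜ b) = HilbertTensor.map (π a) (ρ b) := rfl

lemma tensorRep_comm_coe (π : A →⋆ₐ[ℂ] (H →L[ℂ] H)) (ρ : B →⋆ₐ[ℂ] (K →L[ℂ] K))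
    (x : AlgTensor A B) (v : H ⊗[ℂ] K) :
    ∃ z : H ⊗[ℂ] K, tensorRep π ρ x (HilbertTensor.coe v) = HilbertTensor.coe z ∧
      tensorRep ρ π (Algebra.TensorProduct.comm ℂ A B x)
        (HilbertTensor.coe (TensorProduct.comm ℂ H K v)) =
      HilbertTensor.coe (TensorProduct.comm ℂ H K z) := by
  induction x using TensorProduct.induction_on with
  | zero => exact ⟨0, by simp [HilbertTensor.coe_zero]⟩
  | add x y hx hy =>
    obtain ⟨z, h1, h2⟩ := hx
    obtain ⟨z', h1', h2'⟩ := hy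
    refine ⟨z + z', ?_, ?_⟩
    · rw [map_add, add_apply, h1, h1', HilbertTensor.coe_add]
    · rw [map_add, map_add, add_apply, h2, h2', map_add, HilbertTensor.coe_add]
  | tmul a b =>
    refine ⟨TensorProduct.mapL (π a) (ρ b) v, HilbertTensor.map_coe _ _ _, ?_⟩
    refine (HilbertTensor.map_coe _ _ _).trans ?_
    congr 1
    induction v using TensorProduct.induction_on with
    | zero => simp
    | add v w hv hw => simp only [map_add, hv, hw]
    | tmul h k => rfl

lemma norm_tensorRep_comm_le (π : A →⋆ₐ[ℂ] (H →L[ℂ] H)) (ρ : B →⋆ₐ[ℂ] (K →L[ℂ] K))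
    (x : AlgTensor A B) :
    ‖tensorRep ρ π (Algebra.TensorProduct.comm ℂ A B x)‖ ≤ ‖tensorRep π ρ x‖ := by
  refine ContinuousLinearMap.opNorm_le_bound _ (norm_nonneg _) fun w => ?_
  induction w using HilbertTensor.induction with
  | hP => exact isClosed_le (by fun_prop) (by fun_prop)
  | h w =>
    obtain ⟨v, rfl⟩ := (TensorProduct.comm ℂ H K).surjective w
    obtain ⟨z, h1, h2⟩ := tensorRep_comm_coe π ρ x v
    rw [h2, HilbertTensor.norm_coe, HilbertTensor.norm_coe, TensorProduct.norm_comm,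
      TensorProduct.norm_comm, ← HilbertTensor.norm_coe, ← HilbertTensor.norm_coe, ← h1]
    exact ContinuousLinearMap.le_opNorm _ _

end

end Spatial

/-! ### The minimal tensor product of C⋆-algebras -/

section MinTensor

variable (A B : Type u) [CStarAlgebra A] [CStarAlgebra B]

/-- The seminorms `x ↦ ‖(π ⊗ ρ) x‖` on the algebraic tensor product, for all pairs of
representations `π` of `A` and `ρ` of `B` on Hilbert spaces. -/
def spatialSeminorms : Set (CStarSeminorm (AlgTensor A B)) :=
  {p | ∃ (H K : Type u) (_ : NormedAddCommGroup H) (_ : InnerProductSpace ℂ H)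
    (_ : CompleteSpace H) (_ : NormedAddCommGroup K) (_ : InnerProductSpace ℂ K)
    (_ : CompleteSpace K) (π : A →⋆ₐ[ℂ] (H →L[ℂ] H)) (ρ : B →⋆ₐ[ℂ] (K →L[ℂ] K)),
    p = CStarSeminorm.ofHom (tensorRep π ρ)}

lemma spatialSeminorms_bddAbove (x : AlgTensor A B) :
    BddAbove (Set.range fun p : spatialSeminorms A B => p.1 x) := by
  suffices h : ∃ C, ∀ p ∈ spatialSeminorms A B, p x ≤ C by
    obtain ⟨C, hC⟩ := h
    exact ⟨C, by rintro _ ⟨p, rfl⟩; exact hC p.1 p.2⟩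
  induction x using TensorProduct.induction_on with
  | zero => exact ⟨0, fun p _ => (map_zero p.toSeminorm).le⟩
  | add a b ha hb =>
    obtain ⟨C, hC⟩ := ha
    obtain ⟨D, hD⟩ := hb
    exact ⟨C + D, fun p hp => (map_add_le_add p.toSeminorm a b).trans
      (add_le_add (hC p hp) (hD p hp))⟩
  | tmul a b =>
    refine ⟨‖a‖ * ‖b‖, ?_⟩
    rintro _ ⟨H, K, _, _, _, _, _, _, π, ρ, rfl⟩
    change ‖HilbertTensor.map (π a) (ρ b)‖ ≤ _
    exact (HilbertTensor.norm_map_le _ _).trans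
      (mul_le_mul (NonUnitalStarAlgHom.norm_apply_le π a) (NonUnitalStarAlgHom.norm_apply_le ρ b)
        (norm_nonneg _) (norm_nonneg _))

/-- The minimal (spatial) C⋆-norm `‖x‖ = sup ‖(π ⊗ ρ) x‖` on the algebraic tensor product. -/
def minSeminorm : CStarSeminorm (AlgTensor A B) :=
  CStarSeminorm.sup (spatialSeminorms A B) (spatialSeminorms_bddAbove A B)

/-- The minimal tensor product of two unital C⋆-algebras: the completion of the algebraic tensor
product in the minimal C⋆-norm. -/
def MinTensor : Type u := (minSeminorm A B).Completion

instance : CStarAlgebra (MinTensor A B) :=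
  inferInstanceAs (CStarAlgebra (minSeminorm A B).Completion)

namespace MinTensor

/-- The canonical ⋆-homomorphism from the algebraic to the minimal tensor product. -/
def ofTensor : AlgTensor A B →⋆ₐ[ℂ] MinTensor A B := (minSeminorm A B).toCompletion

variable {A B}

/-- The elementary tensor `a ⊗ b` in the minimal tensor product. -/
def tmul (a : A) (b : B) : MinTensor A B := ofTensor A B (a ⊗ₜ[ℂ] b : AlgTensor A B)

lemma minSeminorm_comm_le (x : AlgTensor A B) :
    minSeminorm B A (Algebra.TensorProduct.comm ℂ A B x) ≤ minSeminorm A B x := by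
  refine Real.iSup_le ?_ ((minSeminorm A B).nonneg x)
  rintro ⟨_, K, H, _, _, _, _, _, _, ρ, π, rfl⟩
  exact (norm_tensorRep_comm_le π ρ x).trans
    (le_ciSup (spatialSeminorms_bddAbove A B x)
      ⟨CStarSeminorm.ofHom (tensorRep π ρ), H, K, _, _, _, _, _, _, π, ρ, rfl⟩)

variable (A B)

/-- The flip of the algebraic tensor product, as a ⋆-homomorphism to the minimal tensor
product. -/
def preFlip : AlgTensor A B →⋆ₐ[ℂ] MinTensor B A where
  toAlgHom := (ofTensor B A).toAlgHom.comp (Algebra.TensorProduct.comm ℂ A B).toAlgHom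
  map_star' x := by
    change ofTensor B A (Algebra.TensorProduct.comm ℂ A B (star x)) =
      star (ofTensor B A (Algebra.TensorProduct.comm ℂ A B x))
    rw [← map_star]
    congr 1
    induction x using TensorProduct.induction_on with
    | zero => simp
    | add x y hx hy => simp only [map_add, star_add, hx, hy]
    | tmul a b => rfl

/-- The flip `a ⊗ b ↦ b ⊗ a` of the minimal tensor product. -/
def flip : MinTensor A B →⋆ₐ[ℂ] MinTensor B A :=
  (minSeminorm A B).lift (preFlip A B) fun x =>
    ((minSeminorm B A).norm_coe _).le.trans (minSeminorm_comm_le x)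

lemma flip_tmul (a : A) (b : B) : flip A B (tmul a b) = tmul b a :=
  (minSeminorm A B).lift_coe _ _ _

end MinTensor

end MinTensor

/-! ### Woronowicz algebras -/

section Woronowicz

variable {A : Type u} [CStarAlgebra A]

/-- A unital C⋆-algebra `A` together with a unital ⋆-homomorphism `Δ : A → A ⊗ A` is a Woronowicz
algebra (compact quantum group) if there is a family of unitary matrices over `A` such that
the entries generate a dense subalgebra, `Δ` is given on entries by the matrix comultiplication,
and the transposed matrices are invertible. -/
def IsWoronowiczAlgebra (Δ : A →⋆ₐ[ℂ] MinTensor A A) : Prop :=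
  ∃ (Λ : Type u) (d : Λ → ℕ) (w : ∀ l, Matrix (Fin (d l)) (Fin (d l)) A),
    (∀ l, w l ∈ unitary (Matrix (Fin (d l)) (Fin (d l)) A)) ∧
    Dense (Algebra.adjoin ℂ {a : A | ∃ l i j, a = w l i j} : Set A) ∧
    (∀ l i j, Δ (w l i j) = ∑ k, MinTensor.tmul (w l i k) (w l k j)) ∧
    (∀ l, IsUnit (w l).transpose)

/-- `(A, Δ)` is cocommutative if `Δ` is invariant under the flip of `A ⊗ A`. -/
def IsCocommutative (Δ : A →⋆ₐ[ℂ] MinTensor A A) : Prop :=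
  ∀ a, MinTensor.flip A A (Δ a) = Δ a

end Woronowicz

end

/-!
A ⋆-homomorphism out of `A_aut(G)` is the same as a matrix over the target whose entries satisfy
the defining relations (`IsQAutMatrix.exists_hom`). Everything follows by writing down such
matrices.

* The matrix `∑ k, X i k ⊗ X k j` satisfies the relations (`IsQAutMatrix.tensor`), because in a
  product of two of its entries at adjacent vertices the first tensor factor vanishes unless the
  intermediate pair of vertices is an edge. This gives `Δ`. The matrix `X` and its transpose are
  unitary, so `Δ` makes `A_aut(G)` a Woronowicz algebra.
* In a disjoint union, edges join vertices of the same copy, so no relation links a nonzero entry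
  of one diagonal block with one of another: a block diagonal matrix whose blocks satisfy the
  relations of `G` satisfies those of the union, without any commutation between the blocks
  (`IsQAutMatrix.copies`). If `σ` is an automorphism of `G`, each projection `p` gives such a block,
  the mixture of the identity and the permutation matrix of `σ` with weights `p` and `1 - p`.
  If `σ` moves the vertex `v`, two blocks thus send two diagonal generators `x`, `y` to an arbitrary
  pair of projections (`QAut.exists_rep`). Two projections of `ℂ²` need not commute, and when `x`
  and `y` go to two lines at angle `θ`, the element `x y x` acquires the eigenvalue `cos² θ`. As `θ`
  varies, this excludes a polynomial equation for `x y x`, hence finite dimension.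
* Evaluation at an automorphism is a character of `A_aut(G)`, and `Δ` turns products of characters
  into compositions of automorphisms. If `Δ` were cocommutative, any two automorphisms would
  commute, but exchanging two copies does not commute with applying `σ` to one of them.
-/

/-! ### The universal property of `A_aut(G)` -/

namespace FreeSelfAdj

variable {X B : Type*} [Ring B] [Algebra ℂ B]

/-- The algebra homomorphism underlying `FreeSelfAdj.lift`. -/
noncomputable def liftAlgHom (x : X → B) : FreeSelfAdj X →ₐ[ℂ] B :=
  MonoidAlgebra.lift ℂ B (FreeMonoid X) (FreeMonoid.lift x)

lemma liftAlgHom_monomial (x : X → B) (w : FreeMonoid X) (c : ℂ) :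
    liftAlgHom x (monomial w c) = c • FreeMonoid.lift x w :=
  MonoidAlgebra.lift_single _ _ _

variable [StarRing B] [StarModule ℂ B] (x : X → B) (hx : ∀ i, star (x i) = x i)

/-- The ⋆-homomorphism from the free ⋆-algebra sending the generators to given self-adjoint
elements. -/
noncomputable def lift : FreeSelfAdj X →⋆ₐ[ℂ] B where
  toAlgHom := liftAlgHom x
  map_star' a := by
    have hw (w : FreeMonoid X) :
        FreeMonoid.lift x (star w) = star (FreeMonoid.lift x w) := by
      induction w using FreeMonoid.inductionOn' with
      | one => simp
      | of_mul i w hw => rw [star_mul, map_mul, map_mul, hw, star_mul, FreeMonoid.star_of,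
          FreeMonoid.lift_eval_of, hx]
    change liftAlgHom x (star a) = star (liftAlgHom x a)
    induction a using induction with
    | zero => rw [star_zero, map_zero, star_zero]
    | add a b ha hb => rw [star_add, map_add, map_add, star_add, ha, hb]
    | monomial w c =>
      rw [star_monomial, liftAlgHom_monomial, liftAlgHom_monomial, star_smul, hw]

lemma lift_gen (i : X) : lift x hx (gen i) = x i := by
  refine (liftAlgHom_monomial _ _ _).trans ?_
  rw [one_smul, FreeMonoid.lift_eval_of]

end FreeSelfAdj

/-- A square matrix `x` over a ⋆-ring, indexed by the vertices of `G`, that satisfies the relations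
of `A_aut(G)`. The relations of `QAutRel` not listed here are consequences of these. -/
structure IsQAutMatrix {V B : Type*} [Fintype V] [Ring B] [StarRing B] (G : Digraph V)
    (x : V → V → B) : Prop where
  star_eq : ∀ i j, star (x i j) = x i j
  row_orth : ∀ i j k, j ≠ k → x i j * x i k = 0
  col_orth : ∀ i j k, j ≠ k → x j i * x k i = 0
  row_sum : ∀ i, ∑ l, x i l = 1
  col_sum : ∀ i, ∑ l, x l i = 1
  edge_row : ∀ s t i k, G.Adj s t → ¬ G.Adj i k → x s i * x t k = 0
  edge_col : ∀ s t i k, G.Adj s t → ¬ G.Adj i k → x i s * x k t = 0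
  edge_comm : ∀ s t s' t', G.Adj s t → G.Adj s' t' →
    x s s' * x t t' = x t t' * x s s'

namespace IsQAutMatrix

variable {V B : Type*} [Fintype V] {G : Digraph V}

section
variable [Ring B] [StarRing B] {x : V → V → B} (hx : IsQAutMatrix G x)
include hx

lemma transpose : IsQAutMatrix G fun i j => x j i where
  star_eq i j := hx.star_eq j i
  row_orth := hx.col_orth
  col_orth := hx.row_orth
  row_sum := hx.col_sum
  col_sum := hx.row_sum
  edge_row := hx.edge_col
  edge_col := hx.edge_row
  edge_comm s t s' t' h h' := hx.edge_comm s' t' s t h' h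

lemma idem (i j : V) : x i j * x i j = x i j := by
  classical
  calc x i j * x i j = x i j * ∑ l, x i l := by
        rw [Finset.mul_sum, Finset.sum_eq_single j]
        · exact fun l _ hl => hx.row_orth _ _ _ hl.symm
        · simp
    _ = x i j := by rw [hx.row_sum, mul_one]

lemma edge_row' {s t i k : V} (h : G.Adj s t) (h' : ¬ G.Adj i k) : x t k * x s i = 0 := by
  have := congrArg star (hx.edge_row s t i k h h')
  rwa [star_mul, hx.star_eq, hx.star_eq, star_zero] at this

lemma edge_sum {s t : V} (h : G.Adj s t) : ∑ e ∈ G.edges, x e.1 s * x e.2 t = 1 := by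
  classical
  calc ∑ e ∈ G.edges, x e.1 s * x e.2 t = ∑ e : V × V, x e.1 s * x e.2 t := by
        refine Finset.sum_subset (Finset.subset_univ _) fun e _ he => ?_
        exact hx.edge_col _ _ _ _ h (by simpa [Digraph.edges] using he)
    _ = (∑ i, x i s) * ∑ k, x k t := by
        rw [Fintype.sum_prod_type, Finset.sum_mul_sum]
    _ = 1 := by rw [hx.col_sum, hx.col_sum, one_mul]

lemma map {C : Type*} [Ring C] [StarRing C] {F : Type*} [FunLike F B C] [RingHomClass F B C]
    [StarHomClass F B C] (f : F) : IsQAutMatrix G fun i j => f (x i j) where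
  star_eq i j := by rw [← map_star, hx.star_eq]
  row_orth i j k h := by rw [← map_mul, hx.row_orth i j k h, map_zero]
  col_orth i j k h := by rw [← map_mul, hx.col_orth i j k h, map_zero]
  row_sum i := by rw [← map_sum, hx.row_sum, map_one]
  col_sum i := by rw [← map_sum, hx.col_sum, map_one]
  edge_row s t i k h h' := by rw [← map_mul, hx.edge_row s t i k h h', map_zero]
  edge_col s t i k h h' := by rw [← map_mul, hx.edge_col s t i k h h', map_zero]
  edge_comm s t s' t' h h' := by rw [← map_mul, ← map_mul, hx.edge_comm s t s' t' h h']

end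

section
variable [CStarAlgebra B] {x : V → V → B} (hx : IsQAutMatrix G x)
include hx

lemma freeLift_eq {a b : FreeSelfAdj (V × V)} (h : QAutRel G a b) :
    FreeSelfAdj.lift (fun e : V × V => x e.1 e.2) (fun e => hx.star_eq e.1 e.2) a =
      FreeSelfAdj.lift (fun e : V × V => x e.1 e.2) (fun e => hx.star_eq e.1 e.2) b := by
  have mem {γ : V × V} (h : γ ∈ G.edges) : G.Adj γ.1 γ.2 := by
    simpa [Digraph.edges] using h
  cases h <;> simp only [map_mul, map_sum, map_zero, map_one, FreeSelfAdj.lift_gen]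
  case row_idem i j => exact hx.idem i j
  case row_orth i j k h => exact hx.row_orth i j k h
  case col_orth i j k h => exact hx.col_orth i j k h
  case row_sum i => exact hx.row_sum i
  case col_sum i => exact hx.col_sum i
  case edge_row γ i k hγ h => exact hx.edge_row _ _ _ _ (mem hγ) h
  case edge_row' γ i k hγ h => exact hx.edge_row' (mem hγ) h
  case edge_col γ i k hγ h => exact hx.edge_col _ _ _ _ (mem hγ) h
  case edge_col' γ i k hγ h => exact hx.transpose.edge_row' (mem hγ) h
  case edge_comm γ γ' hγ hγ' => exact hx.edge_comm _ _ _ _ (mem hγ) (mem hγ')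
  case edge_sum γ hγ => exact hx.edge_sum (mem hγ)
  case edge_sum' γ hγ => exact hx.transpose.edge_sum (mem hγ)

/-- The universal property of `A_aut(G)`. -/
lemma exists_hom : ∃ π : QAut G →⋆ₐ[ℂ] B, ∀ i j, π (QAut.gen G i j) = x i j := by
  let f := FreeSelfAdj.lift (fun e : V × V => x e.1 e.2) (fun e => hx.star_eq e.1 e.2)
  have hf : CStarSeminorm.ofHom f ∈ qAutSeminorms G := fun a b h => by
    rw [CStarSeminorm.ofHom_apply, map_sub, hx.freeLift_eq h, sub_self, norm_zero]
  have hle (a) : ‖f a‖ ≤ qAutSeminorm G a :=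
    le_ciSup (FreeSelfAdj.exists_bound _ (qAutSeminorms_gen_le G) a)
      (⟨_, hf⟩ : qAutSeminorms G)
  exact ⟨(qAutSeminorm G).lift f hle, fun i j =>
    ((qAutSeminorm G).lift_coe f hle _).trans (FreeSelfAdj.lift_gen _ _ _)⟩

end

end IsQAutMatrix

namespace QAut

variable {V : Type*} [Fintype V] (G : Digraph V)

lemma mk_eq_of_rel {a b : FreeSelfAdj (V × V)} (h : QAutRel G a b) : mk G a = mk G b := by
  have h0 : qAutSeminorm G (a - b) = 0 :=
    le_antisymm (Real.iSup_le (fun p => (p.2 a b h).le) le_rfl) ((qAutSeminorm G).nonneg _)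
  rw [← sub_eq_zero, ← map_sub, ← norm_eq_zero]
  exact ((qAutSeminorm G).norm_coe _).trans h0

lemma isQAutMatrix_gen : IsQAutMatrix G (gen G) where
  star_eq i j := by rw [gen, ← map_star, FreeSelfAdj.star_gen]
  row_orth i j k h := by simpa [gen] using mk_eq_of_rel G (.row_orth i j k h)
  col_orth i j k h := by simpa [gen] using mk_eq_of_rel G (.col_orth i j k h)
  row_sum i := by simpa [gen] using mk_eq_of_rel G (.row_sum i)
  col_sum i := by simpa [gen] using mk_eq_of_rel G (.col_sum i)
  edge_row s t i k h h' := by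
    simpa [gen] using mk_eq_of_rel G (.edge_row (s, t) i k (by simpa [Digraph.edges]) h')
  edge_col s t i k h h' := by
    simpa [gen] using mk_eq_of_rel G (.edge_col (s, t) i k (by simpa [Digraph.edges]) h')
  edge_comm s t s' t' h h' := by
    simpa [gen] using mk_eq_of_rel G (.edge_comm (s, t) (s', t') (by simpa [Digraph.edges])
      (by simpa [Digraph.edges]))

lemma dense_adjoin_gen :
    Dense (Algebra.adjoin ℂ (Set.range fun e : V × V => gen G e.1 e.2) : Set (QAut G)) := by
  have hd : DenseRange (mk G) := (qAutSeminorm G).denseRange_coe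
  refine hd.mono ?_
  rintro _ ⟨a, rfl⟩
  set S := Algebra.adjoin ℂ (Set.range fun e : V × V => gen G e.1 e.2)
  change mk G a ∈ S
  induction a using FreeSelfAdj.induction with
  | zero => rw [map_zero]; exact S.zero_mem
  | add a b ha hb => rw [map_add]; exact S.add_mem ha hb
  | monomial w c =>
    have hc : FreeSelfAdj.monomial w c = c • FreeSelfAdj.monomial w 1 := by
      rw [FreeSelfAdj.smul_monomial, mul_one]
    rw [hc, map_smul]
    refine S.smul_mem ?_ c
    clear hc
    induction w using FreeMonoid.inductionOn' with
    | one => rw [← FreeSelfAdj.one_def, map_one]; exact S.one_mem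
    | of_mul e w hw =>
      have : FreeSelfAdj.monomial (FreeMonoid.of e * w) 1 =
          FreeSelfAdj.gen e * FreeSelfAdj.monomial w 1 := by
        rw [FreeSelfAdj.gen, FreeSelfAdj.monomial_mul, one_mul]
      rw [this, map_mul]
      exact S.mul_mem (Algebra.subset_adjoin ⟨e, rfl⟩) hw

end QAut

/-! ### The comultiplication -/

namespace IsQAutMatrix

variable {V : Type*} {A B : Type u} [Fintype V] {G : Digraph V} [Ring A] [Algebra ℂ A] [StarRing A]
  [StarModule ℂ A] [Ring B] [Algebra ℂ B] [StarRing B] [StarModule ℂ B]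

/-- The product of two matrices with entries `x i j ⊗ 1` and `1 ⊗ y i j` satisfies the relations
of `A_aut(G)` when both factors do. -/
lemma tensor {x : V → V → A} {y : V → V → B} (hx : IsQAutMatrix G x) (hy : IsQAutMatrix G y) :
    IsQAutMatrix G fun i j => (∑ k, x i k ⊗ₜ[ℂ] y k j : AlgTensor A B) := by
  classical
  have hmul (i j k l) : (∑ a, x i a ⊗ₜ[ℂ] y a j : AlgTensor A B) * ∑ b, x k b ⊗ₜ[ℂ] y b l =
      ∑ a, ∑ b, (x i a * x k b) ⊗ₜ[ℂ] (y a j * y b l) := by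
    simp_rw [Finset.sum_mul_sum, Algebra.TensorProduct.tmul_mul_tmul]
  refine ⟨fun i j => ?_, fun i j k h => ?_, fun i j k h => ?_, fun i => ?_, fun i => ?_,
    fun s t i k h h' => ?_, fun s t i k h h' => ?_, fun s t s' t' h h' => ?_⟩
  · simp only [star_sum, TensorProduct.star_tmul, hx.star_eq, hy.star_eq]
  · rw [hmul]
    refine Finset.sum_eq_zero fun a _ => Finset.sum_eq_zero fun b _ => ?_
    by_cases hab : a = b
    · rw [hab, hy.row_orth _ _ _ h, TensorProduct.tmul_zero]
    · rw [hx.row_orth _ _ _ hab, TensorProduct.zero_tmul]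
  · rw [hmul]
    refine Finset.sum_eq_zero fun a _ => Finset.sum_eq_zero fun b _ => ?_
    by_cases hab : a = b
    · rw [hab, hx.col_orth _ _ _ h, TensorProduct.zero_tmul]
    · rw [hy.col_orth _ _ _ hab, TensorProduct.tmul_zero]
  · rw [Finset.sum_comm]
    simp_rw [← TensorProduct.tmul_sum, hy.row_sum, ← TensorProduct.sum_tmul, hx.row_sum]
    rfl
  · rw [Finset.sum_comm]
    simp_rw [← TensorProduct.sum_tmul, hx.col_sum, ← TensorProduct.tmul_sum, hy.col_sum]
    rfl
  · rw [hmul]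
    refine Finset.sum_eq_zero fun a _ => Finset.sum_eq_zero fun b _ => ?_
    by_cases hab : G.Adj a b
    · rw [hy.edge_row _ _ _ _ hab h', TensorProduct.tmul_zero]
    · rw [hx.edge_row _ _ _ _ h hab, TensorProduct.zero_tmul]
  · rw [hmul]
    refine Finset.sum_eq_zero fun a _ => Finset.sum_eq_zero fun b _ => ?_
    by_cases hab : G.Adj a b
    · rw [hx.edge_col _ _ _ _ hab h', TensorProduct.zero_tmul]
    · rw [hy.edge_col _ _ _ _ h hab, TensorProduct.tmul_zero]
  · rw [hmul, hmul, Finset.sum_comm]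
    refine Finset.sum_congr rfl fun b _ => Finset.sum_congr rfl fun a _ => ?_
    by_cases hab : G.Adj a b
    · rw [hx.edge_comm _ _ _ _ h hab, hy.edge_comm _ _ _ _ hab h']
    · rw [hx.edge_row _ _ _ _ h hab, hx.edge_row' h hab, TensorProduct.zero_tmul,
        TensorProduct.zero_tmul]

end IsQAutMatrix

namespace QAut

variable {V : Type u} [Fintype V] (G : Digraph V)

theorem exists_comul : ∃ Δ : QAut G →⋆ₐ[ℂ] MinTensor (QAut G) (QAut G),
    ∀ i j, Δ (gen G i j) = ∑ k, MinTensor.tmul (gen G i k) (gen G k j) := by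
  have h := ((isQAutMatrix_gen G).tensor (isQAutMatrix_gen G)).map
    (MinTensor.ofTensor (QAut G) (QAut G))
  obtain ⟨Δ, hΔ⟩ := h.exists_hom
  exact ⟨Δ, fun i j => by rw [hΔ, map_sum]; rfl⟩

theorem isWoronowiczAlgebra {Δ : QAut G →⋆ₐ[ℂ] MinTensor (QAut G) (QAut G)}
    (hΔ : ∀ i j, Δ (gen G i j) = ∑ k, MinTensor.tmul (gen G i k) (gen G k j)) :
    IsWoronowiczAlgebra Δ := by
  let e := (Fintype.equivFin V).symm
  -- A matrix satisfying the relations of `A_aut(G)` is unitary, and so is its transpose.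
  have key {x : V → V → QAut G} (hx : IsQAutMatrix G x) :
      Matrix.of (fun i j => x (e i) (e j)) ∈
        unitary (Matrix (Fin (Fintype.card V)) (Fin (Fintype.card V)) (QAut G)) := by
    rw [Unitary.mem_iff]
    constructor <;> ext i j <;>
      simp only [Matrix.mul_apply, Matrix.star_apply, Matrix.of_apply, hx.star_eq,
        Matrix.one_apply]
    · rw [e.sum_comp fun k => x k (e i) * x k (e j)]
      split_ifs with h
      · simp_rw [h, hx.idem, hx.col_sum]
      · exact Finset.sum_eq_zero fun k _ => hx.row_orth _ _ _ (e.injective.ne h)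
    · rw [e.sum_comp fun k => x (e i) k * x (e j) k]
      split_ifs with h
      · simp_rw [h, hx.idem, hx.row_sum]
      · exact Finset.sum_eq_zero fun k _ => hx.col_orth _ _ _ (e.injective.ne h)
  refine ⟨PUnit, fun _ => Fintype.card V, fun _ => Matrix.of fun i j => gen G (e i) (e j),
    fun _ => key (isQAutMatrix_gen G), ?_, fun _ i j => ?_, fun _ => ?_⟩
  · refine (dense_adjoin_gen G).mono (Algebra.adjoin_mono ?_)
    rintro _ ⟨⟨i, j⟩, rfl⟩
    exact ⟨⟨⟩, e.symm i, e.symm j, by simp⟩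
  · simp only [Matrix.of_apply, hΔ]
    exact (e.sum_comp fun k => MinTensor.tmul (gen G (e i) k) (gen G k (e j))).symm
  · exact (Unitary.toUnits ⟨_, key (isQAutMatrix_gen G).transpose⟩).isUnit

end QAut

/-! ### Matrices built from automorphisms and projections -/

open Classical in
/-- The matrix with entries `p • [i = g j] + (1 - p) • [i = h j]`: the permutation matrices of `g`
and `h`, mixed by the projections `p` and `1 - p`. -/
noncomputable def mixedPerm {V B : Type*} [Ring B] (p : B) (g h : V → V) (i j : V) : B :=
  (if i = g j then p else 0) + (if i = h j then 1 - p else 0)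

namespace IsQAutMatrix

variable {V B : Type*} [Fintype V] {G : Digraph V} [Ring B] [StarRing B]

lemma mixedPerm {p : B} (hp : IsStarProjection p) (g h : G.Adj ≃r G.Adj) :
    IsQAutMatrix G (mixedPerm p g h) := by
  classical
  have hpp : p * p = p := hp.isIdempotentElem
  have hps : star p = p := hp.isSelfAdjoint
  have hpq : p * (1 - p) = 0 := by rw [mul_sub, mul_one, hpp, sub_self]
  have hqp : (1 - p) * p = 0 := by rw [sub_mul, one_mul, hpp, sub_self]
  have hmul (i j k l) : _root_.mixedPerm p g h i j * _root_.mixedPerm p g h k l =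
      (if i = g j ∧ k = g l then p else 0) + (if i = h j ∧ k = h l then 1 - p else 0) := by
    have hqq : (1 - p) * (1 - p) = 1 - p := by rw [mul_sub, mul_one, hqp, sub_zero]
    simp only [_root_.mixedPerm, add_mul, mul_add, ite_mul, mul_ite, zero_mul, mul_zero, hpp, hpq,
      hqp, hqq, ite_self, add_zero, zero_add, ite_and]
    congr 1 <;> split_ifs <;> rfl
  refine ⟨fun i j => ?_, fun i j k hjk => ?_, fun i j k hjk => ?_, fun i => ?_, fun i => ?_,
    fun s t i k hst hik => ?_, fun s t i k hst hik => ?_, fun s t s' t' _ _ => ?_⟩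
  · simp only [_root_.mixedPerm, star_add, apply_ite star, star_sub, star_one, star_zero, hps]
  · rw [hmul, if_neg, if_neg, add_zero]
    · rintro ⟨h1, h2⟩; exact hjk (h.injective (h1.symm.trans h2))
    · rintro ⟨h1, h2⟩; exact hjk (g.injective (h1.symm.trans h2))
  · rw [hmul, if_neg, if_neg, add_zero]
    · rintro ⟨h1, h2⟩; exact hjk (h1.trans h2.symm)
    · rintro ⟨h1, h2⟩; exact hjk (h1.trans h2.symm)
  · have hg (l) : i = g l ↔ g.symm i = l := g.toEquiv.symm_apply_eq.symm
    have hh (l) : i = h l ↔ h.symm i = l := h.toEquiv.symm_apply_eq.symm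
    simp [_root_.mixedPerm, Finset.sum_add_distrib, hg, hh]
  · simp [_root_.mixedPerm, Finset.sum_add_distrib]
  · rw [hmul, if_neg, if_neg, add_zero]
    · rintro ⟨rfl, rfl⟩; exact hik (h.map_rel_iff.1 hst)
    · rintro ⟨rfl, rfl⟩; exact hik (g.map_rel_iff.1 hst)
  · rw [hmul, if_neg, if_neg, add_zero]
    · rintro ⟨rfl, rfl⟩; exact hik (h.map_rel_iff.2 hst)
    · rintro ⟨rfl, rfl⟩; exact hik (g.map_rel_iff.2 hst)
  · rw [hmul, hmul]
    simp only [and_comm]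

/-- A block diagonal matrix satisfies the relations of the disjoint union if its blocks satisfy
those of the components. Entries of different blocks need not commute. -/
lemma copies {n : ℕ} {x : Fin n → V → V → B} (hx : ∀ a, IsQAutMatrix G (x a)) :
    IsQAutMatrix (G.copies n) fun i j => if i.1 = j.1 then x i.1 i.2 j.2 else 0 := by
  classical
  refine ⟨fun i j => ?_, fun i j k hjk => ?_, fun i j k hjk => ?_, fun i => ?_, fun i => ?_,
    ?_, ?_, ?_⟩
  · simp only [apply_ite star, star_zero, (hx _).star_eq]
  · obtain ⟨a, i⟩ := i
    obtain ⟨b, j⟩ := j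
    obtain ⟨c, k⟩ := k
    simp only [ite_mul, mul_ite, zero_mul, mul_zero]
    split_ifs with h1 h2 <;> try rfl
    subst h1 h2
    exact (hx _).row_orth _ _ _ fun h => hjk (h ▸ rfl)
  · obtain ⟨a, i⟩ := i
    obtain ⟨b, j⟩ := j
    obtain ⟨c, k⟩ := k
    simp only [ite_mul, mul_ite, zero_mul, mul_zero]
    split_ifs with h1 h2 <;> try rfl
    subst h1 h2
    exact (hx _).col_orth _ _ _ fun h => hjk (h ▸ rfl)
  · rw [Fintype.sum_prod_type, Finset.sum_eq_single i.1]
    · simp [(hx _).row_sum]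
    · exact fun c _ hc => Finset.sum_eq_zero fun _ _ => if_neg hc.symm
    · simp
  · rw [Fintype.sum_prod_type, Finset.sum_eq_single i.1]
    · simp [(hx _).col_sum]
    · exact fun c _ hc => Finset.sum_eq_zero fun _ _ => if_neg hc
    · simp
  · rintro ⟨a, s⟩ ⟨_, t⟩ ⟨b, i⟩ ⟨c, k⟩ ⟨h, hst⟩ hik
    obtain rfl : a = _ := h
    simp only [ite_mul, mul_ite, zero_mul, mul_zero]
    split_ifs with h1 h2 <;> try rfl
    subst h1 h2
    exact (hx _).edge_row _ _ _ _ hst fun h => hik ⟨rfl, h⟩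
  · rintro ⟨a, s⟩ ⟨_, t⟩ ⟨b, i⟩ ⟨c, k⟩ ⟨h, hst⟩ hik
    obtain rfl : a = _ := h
    simp only [ite_mul, mul_ite, zero_mul, mul_zero]
    split_ifs with h1 h2 <;> try rfl
    subst h1 h2
    exact (hx _).edge_col _ _ _ _ hst fun h => hik ⟨rfl, h⟩
  · rintro ⟨a, s⟩ ⟨_, t⟩ ⟨b, s'⟩ ⟨_, t'⟩ ⟨h, hst⟩ ⟨h', hst'⟩
    obtain rfl : a = _ := h
    obtain rfl : b = _ := h'
    dsimp only at hst hst' ⊢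
    split_ifs with h1
    · exact (hx _).edge_comm _ _ _ _ hst hst'
    · rfl

end IsQAutMatrix

/-! ### Noncommutativity and infinite dimension -/

section Projections

open scoped Matrix.Norms.L2Operator

/-- The projection of `ℂ²` onto the first coordinate axis. -/
def axisProj : Matrix (Fin 2) (Fin 2) ℂ := !![1, 0; 0, 0]

/-- The projection of `ℂ²` onto the line spanned by `(√t, √(1 - t))`, for `0 ≤ t ≤ 1`. -/
noncomputable def lineProj (t : ℝ) : Matrix (Fin 2) (Fin 2) ℂ :=
  !![(t : ℂ), (Real.sqrt (t * (1 - t)) : ℂ); (Real.sqrt (t * (1 - t)) : ℂ), 1 - t]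

lemma isStarProjection_axisProj : IsStarProjection axisProj := by
  refine ⟨?_, ?_⟩
  · rw [IsIdempotentElem]
    ext i j
    fin_cases i <;> fin_cases j <;> simp [axisProj]
  · ext i j
    fin_cases i <;> fin_cases j <;> simp [axisProj, Matrix.star_apply]

lemma isStarProjection_lineProj {t : ℝ} (h0 : 0 ≤ t) (h1 : t ≤ 1) :
    IsStarProjection (lineProj t) := by
  have hs : (Real.sqrt (t * (1 - t)) : ℂ) * Real.sqrt (t * (1 - t)) = t * (1 - t) := by
    rw [← Complex.ofReal_mul, Real.mul_self_sqrt (mul_nonneg h0 (sub_nonneg.2 h1))]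
    push_cast
    rfl
  refine ⟨?_, ?_⟩
  · rw [IsIdempotentElem, lineProj]
    ext i j
    fin_cases i <;> fin_cases j <;> simp [Matrix.mul_apply, hs] <;> ring
  · ext i j
    fin_cases i <;> fin_cases j <;> simp [lineProj, Matrix.star_apply]

lemma axisProj_mul_lineProj_mul_axisProj (t : ℝ) :
    axisProj * lineProj t * axisProj = (t : ℂ) • axisProj := by
  ext i j
  fin_cases i <;> fin_cases j <;> simp [axisProj, lineProj]

lemma axisProj_mul_lineProj_ne : axisProj * lineProj (1 / 2) ≠ lineProj (1 / 2) * axisProj := by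
  intro h
  have := congrFun₂ h 0 1
  norm_num [axisProj, lineProj] at this

end Projections

/-- A polynomial in a multiple of an idempotent. -/
lemma aeval_smul_idempotent_mul {B : Type*} [Ring B] [Algebra ℂ B] {p : B} (hp : p * p = p)
    (c : ℂ) (f : Polynomial ℂ) : Polynomial.aeval (c • p) f * p = f.eval c • p := by
  induction f using Polynomial.induction_on' with
  | add f g hf hg => rw [map_add, add_mul, hf, hg, Polynomial.eval_add, add_smul]
  | monomial k a =>
    have hk : p ^ k * p = p := by
      induction k with
      | zero => simp
      | succ k ih => rw [pow_succ, mul_assoc, hp, ih]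
    rw [Polynomial.aeval_monomial, Polynomial.eval_monomial, smul_pow, mul_assoc, smul_mul_assoc,
      hk, ← Algebra.smul_def, smul_smul]

namespace QAut

variable {V : Type*} [Fintype V] {G : Digraph V}

/-- If `σ` is an automorphism of `G` that moves `v`, two of the diagonal generators of
`A_aut(G ∐ ⋯ ∐ G)` may be represented by an arbitrary pair of projections. -/
lemma exists_rep (σ : G.Adj ≃r G.Adj) {v : V} (hv : σ v ≠ v) {n : ℕ} {a b : Fin n} (hab : a ≠ b)
    {B : Type*} [CStarAlgebra B] {p q : B} (hp : IsStarProjection p) (hq : IsStarProjection q) :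
    ∃ π : QAut (G.copies n) →⋆ₐ[ℂ] B,
      π (gen (G.copies n) (a, v) (a, v)) = p ∧ π (gen (G.copies n) (b, v) (b, v)) = q := by
  have hP (c : Fin n) : IsStarProjection (if c = a then p else q) := by
    split_ifs <;> assumption
  obtain ⟨π, hπ⟩ := (IsQAutMatrix.copies fun c =>
    IsQAutMatrix.mixedPerm (hP c) (RelIso.refl G.Adj) σ).exists_hom
  refine ⟨π, ?_, ?_⟩ <;> simp [hπ, mixedPerm, hv.symm, hab.symm]

open scoped Matrix.Norms.L2Operator in
theorem exists_mul_ne_mul (σ : G.Adj ≃r G.Adj) {v : V} (hv : σ v ≠ v) {n : ℕ} {a b : Fin n}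
    (hab : a ≠ b) : ∃ x y : QAut (G.copies n), x * y ≠ y * x := by
  obtain ⟨π, h1, h2⟩ := exists_rep σ hv hab isStarProjection_axisProj
    (isStarProjection_lineProj (t := 1 / 2) (by norm_num) (by norm_num))
  refine ⟨gen _ (a, v) (a, v), gen _ (b, v) (b, v), fun h => axisProj_mul_lineProj_ne ?_⟩
  have := congrArg π h
  rwa [map_mul, map_mul, h1, h2] at this

open scoped Matrix.Norms.L2Operator in
theorem not_finiteDimensional (σ : G.Adj ≃r G.Adj) {v : V} (hv : σ v ≠ v) {n : ℕ} {a b : Fin n}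
    (hab : a ≠ b) : ¬ FiniteDimensional ℂ (QAut (G.copies n)) := by
  intro hfin
  set x := gen (G.copies n) (a, v) (a, v)
  set y := gen (G.copies n) (b, v) (b, v)
  -- The element `x y x` would be a root of a nonzero polynomial `f`, but for each `t` in `[0, 1]`
  -- it has a representation in which it has the eigenvalue `t`.
  obtain ⟨f, hf0, hf⟩ := Algebra.IsAlgebraic.isAlgebraic (R := ℂ) (x * y * x)
  refine hf0 (Polynomial.eq_zero_of_infinite_isRoot f ?_)
  refine (((Set.Icc_infinite (zero_lt_one' ℝ)).image Complex.ofReal_injective.injOn)).mono ?_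
  rintro _ ⟨t, ⟨h0, h1⟩, rfl⟩
  obtain ⟨π, hx, hy⟩ := exists_rep σ hv hab isStarProjection_axisProj
    (isStarProjection_lineProj h0 h1)
  have h : Polynomial.aeval (π (x * y * x)) f = 0 := by
    rw [← map_zero π, ← hf]
    exact Polynomial.aeval_algHom_apply π.toAlgHom _ f
  rw [map_mul, map_mul, hx, hy, axisProj_mul_lineProj_mul_axisProj] at h
  have h' := aeval_smul_idempotent_mul isStarProjection_axisProj.isIdempotentElem (t : ℂ) f
  rw [h, zero_mul] at h'
  simpa [axisProj] using (congrFun₂ h' 0 0).symm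

end QAut

/-! ### Noncocommutativity -/

/-- The automorphism of a disjoint union that applies `σ` to the copy `a` and is the identity on
the others. -/
noncomputable def copyAut {V : Type*} {G : Digraph V} (σ : G.Adj ≃r G.Adj) {n : ℕ} (a : Fin n) :
    (G.copies n).Adj ≃r (G.copies n).Adj where
  toEquiv := Equiv.prodShear (Equiv.refl _) fun c => if c = a then σ.toEquiv else Equiv.refl _
  map_rel_iff' := by
    rintro ⟨c, i⟩ ⟨d, j⟩
    simp only [Digraph.copies, Equiv.prodShear_apply, Equiv.refl_apply]
    refine and_congr_right ?_
    rintro rfl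
    split_ifs
    · exact σ.map_rel_iff
    · rfl

/-- The automorphism of a disjoint union given by a permutation of the copies. -/
def copyPerm {V : Type*} (G : Digraph V) {n : ℕ} (τ : Equiv.Perm (Fin n)) :
    (G.copies n).Adj ≃r (G.copies n).Adj where
  toEquiv := Equiv.prodCongr τ (Equiv.refl V)
  map_rel_iff' := by
    rintro ⟨c, i⟩ ⟨d, j⟩
    simp [Digraph.copies]

namespace QAut

variable {V : Type u} [Fintype V] {G : Digraph V}

/-- The representation of `A_aut(G)` on a one-dimensional Hilbert space given by evaluation at an
automorphism of `G`. The Hilbert space is `ℂ` lifted to the universe of `V`. -/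
lemma exists_character (g : G.Adj ≃r G.Adj) :
    ∃ π : QAut G →⋆ₐ[ℂ]
        (EuclideanSpace ℂ PUnit.{u + 1} →L[ℂ] EuclideanSpace ℂ PUnit.{u + 1}),
      ∀ i j, (i = g j → π (gen G i j) = 1) ∧ (i ≠ g j → π (gen G i j) = 0) := by
  obtain ⟨π, hπ⟩ := (IsQAutMatrix.mixedPerm
    (B := EuclideanSpace ℂ PUnit.{u + 1} →L[ℂ] EuclideanSpace ℂ PUnit.{u + 1}) (.one _) g g).exists_hom
  refine ⟨π, fun i j => ⟨fun h => ?_, fun h => ?_⟩⟩ <;> simp [hπ, mixedPerm, h]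

/-- Cocommutativity forces the automorphisms of `G` to commute. -/
lemma apply_apply_comm_of_isCocommutative {Δ : QAut G →⋆ₐ[ℂ] MinTensor (QAut G) (QAut G)}
    (hΔ : ∀ i j, Δ (gen G i j) = ∑ k, MinTensor.tmul (gen G i k) (gen G k j))
    (hc : IsCocommutative Δ) (g h : G.Adj ≃r G.Adj) (j : V) : g (h j) = h (g j) := by
  classical
  by_contra hne
  obtain ⟨π, hπ⟩ := exists_character g
  obtain ⟨ρ, hρ⟩ := exists_character h
  set i := g (h j)
  let z : AlgTensor (QAut G) (QAut G) := ∑ k, gen G i k ⊗ₜ[ℂ] gen G k j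
  let z' : AlgTensor (QAut G) (QAut G) := ∑ k, gen G k j ⊗ₜ[ℂ] gen G i k
  have hz : MinTensor.ofTensor _ _ (z' - z) = 0 := by
    have := hc (gen G i j)
    rw [hΔ, map_sum] at this
    simp only [MinTensor.flip_tmul] at this
    rw [map_sub, map_sum, map_sum]
    exact sub_eq_zero.2 this
  have hz0 : minSeminorm (QAut G) (QAut G) (z' - z) = 0 := by
    rw [← CStarSeminorm.norm_coe]
    exact norm_eq_zero.2 hz
  have hrep : tensorRep π ρ (z' - z) = 0 := by
    rw [← norm_le_zero_iff, ← hz0]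
    exact le_ciSup (spatialSeminorms_bddAbove (QAut G) (QAut G) (z' - z))
      ⟨CStarSeminorm.ofHom (tensorRep π ρ), _, _, _, _, _, _, _, _, π, ρ, rfl⟩
  have h1 : tensorRep π ρ z = 1 := by
    rw [map_sum, Finset.sum_eq_single (h j)]
    · rw [tensorRep_tmul, (hπ _ _).1 rfl, (hρ _ _).1 rfl, HilbertTensor.map_one]
    · intro k _ hk
      rw [tensorRep_tmul, (hρ _ _).2 hk, ← zero_smul ℂ 0, HilbertTensor.map_smul_right, zero_smul]
    · simp
  have h2 : tensorRep π ρ z' = 0 := by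
    rw [map_sum]
    refine Finset.sum_eq_zero fun k _ => ?_
    rw [tensorRep_tmul]
    by_cases hk : k = g j
    · rw [(hρ i k).2 (hk ▸ hne), ← zero_smul ℂ 0, HilbertTensor.map_smul_right, zero_smul]
    · rw [(hπ k j).2 hk, ← zero_smul ℂ 0, HilbertTensor.map_smul_left, zero_smul]
  rw [map_sub, h1, h2, zero_sub, neg_eq_zero] at hrep
  let e : EuclideanSpace ℂ PUnit.{u + 1} := EuclideanSpace.single PUnit.unit 1
  have he : ‖HilbertTensor.coe (e ⊗ₜ[ℂ] e)‖ = 1 := by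
    rw [HilbertTensor.norm_coe, TensorProduct.norm_tmul]
    simp [e]
  have := congrArg (fun T => ‖T (HilbertTensor.coe (e ⊗ₜ[ℂ] e))‖) hrep
  simp [he] at this

theorem not_isCocommutative (σ : G.Adj ≃r G.Adj) {v : V} (hv : σ v ≠ v) {n : ℕ} {a b : Fin n}
    (hab : a ≠ b)
    {Δ : QAut (G.copies n) →⋆ₐ[ℂ] MinTensor (QAut (G.copies n)) (QAut (G.copies n))}
    (hΔ : ∀ i j, Δ (gen (G.copies n) i j) =
      ∑ k, MinTensor.tmul (gen (G.copies n) i k) (gen (G.copies n) k j)) :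
    ¬ IsCocommutative Δ := by
  intro hc
  have h := apply_apply_comm_of_isCocommutative hΔ hc (copyPerm G (Equiv.swap a b))
    (copyAut σ a) (a, v)
  have h' := congrArg Prod.snd h
  simp [copyPerm, copyAut, hab.symm, hv] at h'

end QAut

theorem corollary4p3 {V : Type u} [Fintype V] (G : Digraph V) (hG : G.IsConnected)
    (hAut : Nontrivial (G.Adj ≃r G.Adj)) (n : ℕ) (hn : 2 ≤ n) :
    ∃ Δ : QAut (G.copies n) →⋆ₐ[ℂ] MinTensor (QAut (G.copies n)) (QAut (G.copies n)),
      (∀ i j, Δ (QAut.gen (G.copies n) i j) =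
        ∑ k, MinTensor.tmul (QAut.gen (G.copies n) i k) (QAut.gen (G.copies n) k j)) ∧
      IsWoronowiczAlgebra Δ ∧
      ¬ FiniteDimensional ℂ (QAut (G.copies n)) ∧
      (∃ a b : QAut (G.copies n), a * b ≠ b * a) ∧
      ¬ IsCocommutative Δ := by
  obtain ⟨σ, hσ⟩ := exists_ne (RelIso.refl G.Adj)
  obtain ⟨v, hv⟩ : ∃ v, σ v ≠ v := by
    by_contra! h
    exact hσ (RelIso.ext h)
  have hab : (⟨0, by omega⟩ : Fin n) ≠ ⟨1, by omega⟩ := by simp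
  obtain ⟨Δ, hΔ⟩ := QAut.exists_comul (G.copies n)
  exact ⟨Δ, hΔ, QAut.isWoronowiczAlgebra _ hΔ, QAut.not_finiteDimensional σ hv hab,
    QAut.exists_mul_ne_mul σ hv hab, QAut.not_isCocommutative σ hv hab hΔ⟩
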